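/- Let $n\ge 1$ and let $A$ be an $n\times n$ complex matrix of class $S_n$: $A$ is a contraction ($\|Ax\|\le\|x\|$ for all $x\in\mathbb{C}^n$, with the Euclidean norm), every eigenvalue of $A$ lies in the open unit disc $\{z\in\mathbb{C}:|z|<1\}$, and $\operatorname{rank}(I_n-A^*A)=1$. For an $m\times m$ complex matrix $B$ let $W(B)=\{\langle Bx,x\rangle : x\in\mathbb{C}^m,\ \|x\|=1\}$ be its numerical range, let $A\otimes A$ be the Kronecker product of $A$ with itself (an $n^2\times n^2$ matrix), and let $J_n$ be the $n\times n$ matrix with ones on the first superdiagonal and zeros elsewhere. A circular disc centered at the origin is a set $\{z\in\mathbb{C}:|z|\le r\}$ with $r\ge 0$ (the one-point set $\{0\}$, $r=0$, is allowed). Then the following conditions are equivalent: (a) $W(A)$ is a circular disc centered at the origin; (b) $W(A\otimes A)$ is a circular disc centered at the origin; (c) $A$ is unitarily similar to $J_n$, that is, $A=U^*J_nU$ for some $n\times n$ unitary matrix $U$. -/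

import Mathlib

open scoped Kronecker

noncomputable section

/-- The numerical range `W(A) = {⟨Ax, x⟩ : ‖x‖ = 1}` for the standard inner product and norm.
Mathlib's `inner ℂ x y` is conjugate-linear in `x` and linear in `y`, so the usual `⟨Ax, x⟩`
(linear in its first slot) is `inner ℂ x (A x)`. -/
def numericalRange {ι : Type*} [Fintype ι] [DecidableEq ι] (A : Matrix ι ι ℂ) : Set ℂ :=
  {z | ∃ x : EuclideanSpace ℂ ι, ‖x‖ = 1 ∧ z = inner ℂ x (Matrix.toEuclideanCLM (𝕜 := ℂ) A x)}

/-- A (closed) circular disc centred at the origin; the radius may be `0`, as for the numerical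
range of the `1 × 1` zero matrix. -/
def IsDiscAtOrigin (s : Set ℂ) : Prop :=
  ∃ r : ℝ, 0 ≤ r ∧ s = Metric.closedBall (0 : ℂ) r

/-- Class `S_n`: contractions (operator norm at most `1`) with all eigenvalues in the open unit
disc and `rank (I - A* A) = 1`. -/
structure IsSnMatrix {n : ℕ} (A : Matrix (Fin n) (Fin n) ℂ) : Prop where
  contraction : ‖Matrix.toEuclideanCLM (𝕜 := ℂ) A‖ ≤ 1
  eigenvalue_lt_one : ∀ z : ℂ, Module.End.HasEigenvalue (Matrix.toLin' A) z → ‖z‖ < 1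
  rank_defect : (1 - A.conjTranspose * A).rank = 1

/-- The `n × n` nilpotent Jordan block, with ones on the first superdiagonal. -/
def jordanBlock (n : ℕ) : Matrix (Fin n) (Fin n) ℂ :=
  Matrix.of fun i j => if (j : ℕ) = (i : ℕ) + 1 then 1 else 0

/-- Unitary similarity of square complex matrices: `A = U* B U` with `U` unitary. -/
def UnitarilySimilar {ι : Type*} [Fintype ι] [DecidableEq ι] (A B : Matrix ι ι ℂ) : Prop :=
  ∃ U ∈ Matrix.unitaryGroup ι ℂ, A = U.conjTranspose * B * U

end

/-! If the numerical range of M is the disc of radius r about 0, then for every unit z the operator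
2r - zM - z̄M* is positive semidefinite and singular. The core is `pow_eq_zero_of_ker_pow_stable`:
if M is a partial isometry and M* maps ker M^j into ker M^(j+1) for j < k, then ker M^k = ker
M^(k+1) forces M^k = 0.

Suppose M^k ≠ 0. A unit vector orthogonal to ker M^k yields a chain of k + 1 unit vectors, so r
bounds the tridiagonal Toeplitz forms up to that size, and the Chebyshev values U_0(r), ..., U_k(r)
are nonzero. These are the pivots needed to push a null vector of 2r - zM - z̄M* through k Schur
complements, down to (ker M^k)ᗮ. The resulting equation is polynomial in z and singular on the whole
unit circle, hence also at z = 0. There it yields a nonzero h in (ker M^k)ᗮ with Mh in ker M^k,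
against stability of the kernels.

The statement passes from A ⊗ A to A by tensoring the relations with themselves. When the defect has
rank one, strict growth gives dim ker A^j = j and an orthonormal Jordan chain, so A is unitarily
similar to J_n. Conversely, zJ_n is unitarily similar to J_n for unit z, and rotation invariance
makes the ranges discs. -/

/-! ### Averaging over roots of unity -/

section RootsOfUnity

open Complex Finset

variable {E : Type*} [NormedAddCommGroup E] [InnerProductSpace ℂ E]

/-- Discrete Parseval identity: averaging over the `N`-th roots of unity kills the cross terms. -/
theorem sum_inner_sum_pow_smul {N : ℕ} {ζ : ℂ} (hζ : IsPrimitiveRoot ζ N) (hζ1 : ‖ζ‖ = 1)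
    (p q : ℕ → E) :
    ∑ t ∈ range N, inner ℂ (∑ l ∈ range N, ((ζ ^ t) ^ l) • p l)
        (∑ i ∈ range N, ((ζ ^ t) ^ i) • q i) =
      N * ∑ i ∈ range N, inner ℂ (p i) (q i) := by
  have hz : ζ ≠ 0 := by rintro rfl; simp at hζ1
  have hconj : (starRingEnd ℂ) ζ = ζ⁻¹ := by
    rw [Complex.inv_def, Complex.normSq_eq_norm_sq, hζ1]; simp
  have key : ∀ l ∈ range N, ∀ i ∈ range N,
      ∑ t ∈ range N, (starRingEnd ℂ) ((ζ ^ t) ^ l) * (ζ ^ t) ^ i = if l = i then (N : ℂ) else 0 := by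
    intro l hl i hi
    rw [mem_range] at hl hi
    have e : ∀ t, (starRingEnd ℂ) ((ζ ^ t) ^ l) * (ζ ^ t) ^ i = (ζ⁻¹ ^ l * ζ ^ i) ^ t := by
      intro t
      rw [map_pow, map_pow, hconj, mul_pow, ← pow_mul, ← pow_mul, ← pow_mul, ← pow_mul,
        mul_comm t l, mul_comm t i]
    simp only [e]
    split_ifs with h
    · subst h
      rw [inv_pow, inv_mul_cancel₀ (pow_ne_zero _ hz)]
      simp
    · have hne : ζ⁻¹ ^ l * ζ ^ i ≠ 1 := by
        intro h1
        apply h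
        rw [inv_pow, inv_mul_eq_one₀ (pow_ne_zero _ hz)] at h1
        exact hζ.pow_inj hl hi h1
      rw [geom_sum_eq hne, mul_pow, ← pow_mul, ← pow_mul, mul_comm l, mul_comm i, pow_mul, pow_mul,
        inv_pow, hζ.pow_eq_one]
      simp
  calc _ = ∑ t ∈ range N, ∑ l ∈ range N, ∑ i ∈ range N,
        ((starRingEnd ℂ) ((ζ ^ t) ^ l) * (ζ ^ t) ^ i) * inner ℂ (p l) (q i) := by
        refine sum_congr rfl fun t _ => ?_
        rw [sum_inner]
        refine sum_congr rfl fun l _ => ?_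
        rw [inner_sum]
        refine sum_congr rfl fun i _ => ?_
        rw [inner_smul_left, inner_smul_right, mul_assoc]
    _ = ∑ l ∈ range N, ∑ i ∈ range N, (if l = i then (N : ℂ) else 0) * inner ℂ (p l) (q i) := by
        rw [sum_comm]
        refine sum_congr rfl fun l hl => ?_
        rw [sum_comm]
        refine sum_congr rfl fun i hi => ?_
        rw [← sum_mul, key l hl i hi]
    _ = _ := by
        rw [mul_sum]
        refine sum_congr rfl fun l hl => ?_
        simp only [ite_mul, zero_mul, sum_ite_eq, hl, if_true]

/-- A bound `r` on all rotated real parts of the quadratic form of `M` dominates the tridiagonal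
Toeplitz form, as soon as `M` has a chain `x, Mx, …, M ^ m x` of unit vectors. -/
theorem tridiagonal_form_le (M : E →L[ℂ] E) (r : ℝ)
    (hr : ∀ z : ℂ, ‖z‖ = 1 → ∀ y : E, (z * inner ℂ y (M y)).re ≤ r * ‖y‖ ^ 2)
    (m : ℕ) (x : E) (hx : ∀ i ≤ m, ‖(M ^ i) x‖ = 1) (b : ℕ → ℝ) :
    ∑ i ∈ range m, b i * b (i + 1) ≤ r * ∑ i ∈ range (m + 1), b i ^ 2 := by
  -- The exponents run up to m + 1, so N = m + 2 keeps them distinct modulo N.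
  set N := m + 2 with hN
  set ζ : ℂ := exp (2 * Real.pi * I / N) with hζdef
  have hζ : IsPrimitiveRoot ζ N := Complex.isPrimitiveRoot_exp N (by omega)
  have hζ1 : ‖ζ‖ = 1 := hζ.norm'_eq_one (by omega)
  -- `q` holds the coefficients of z M(Σ z^l p_l): the chain shifted by one, so that ⟨p_i, q_i⟩ =
  -- b_i b_(i-1) for 1 ≤ i ≤ m.
  set p : ℕ → E := fun l => if l ≤ m then (b l : ℂ) • (M ^ l) x else 0 with hp
  set q : ℕ → E := fun l => if l = 0 then 0 else (b (l - 1) : ℂ) • (M ^ l) x with hq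
  have hsum : ∀ z : ℂ, ∑ i ∈ range N, (z ^ i) • q i = z • M (∑ l ∈ range N, (z ^ l) • p l) := by
    intro z
    rw [hN, sum_range_succ' (fun i => (z ^ i) • q i), sum_range_succ (fun i => (z ^ i) • p i)]
    simp only [hp, hq]
    simp only [Nat.add_eq_zero_iff, one_ne_zero, and_false, if_false, if_true, smul_zero, add_zero,
      Nat.not_succ_le_self, map_sum, smul_sum, Nat.add_sub_cancel]
    refine sum_congr rfl fun i hi => ?_
    rw [if_pos (by rw [mem_range] at hi; omega), map_smul, map_smul, smul_smul z, ← pow_succ',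
      pow_succ' M, mul_apply_eq_comp]
  have h1 := sum_inner_sum_pow_smul hζ hζ1 p q
  have h2 := sum_inner_sum_pow_smul hζ hζ1 p p
  have hle : ∀ t ∈ range N, (inner ℂ (∑ l ∈ range N, ((ζ ^ t) ^ l) • p l)
        (∑ i ∈ range N, ((ζ ^ t) ^ i) • q i)).re ≤
      r * (inner ℂ (∑ l ∈ range N, ((ζ ^ t) ^ l) • p l)
        (∑ i ∈ range N, ((ζ ^ t) ^ i) • p i)).re := by
    intro t _
    rw [hsum, inner_smul_right]
    refine (hr _ (by rw [norm_pow, hζ1, one_pow]) _).trans_eq ?_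
    rw [inner_self_eq_norm_sq_to_K]
    norm_cast
  have h3 := sum_le_sum hle
  rw [← mul_sum, ← Complex.re_sum, ← Complex.re_sum, h1, h2] at h3
  have hN0 : (0 : ℝ) < N := by rw [hN]; positivity
  have e1 : ∑ i ∈ range N, inner ℂ (p i) (q i) = ((∑ i ∈ range m, b i * b (i + 1) : ℝ) : ℂ) := by
    rw [hN, sum_range_succ, sum_range_succ']
    simp only [hp, hq]
    simp only [Nat.add_eq_zero_iff, one_ne_zero, and_false, if_false, if_true, inner_zero_right,
      inner_zero_left, Nat.not_succ_le_self, add_zero, Nat.add_sub_cancel]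
    rw [Complex.ofReal_sum]
    refine sum_congr rfl fun i hi => ?_
    have hi' : i + 1 ≤ m := by rw [mem_range] at hi; omega
    rw [if_pos hi', inner_smul_left, inner_smul_right, inner_self_eq_norm_sq_to_K, hx _ hi',
      Complex.conj_ofReal]
    push_cast
    ring
  have e2 : ∑ i ∈ range N, inner ℂ (p i) (p i) = ((∑ i ∈ range (m + 1), b i ^ 2 : ℝ) : ℂ) := by
    rw [hN, sum_range_succ]
    simp only [hp, Nat.not_succ_le_self, if_false, inner_zero_right, add_zero]
    rw [Complex.ofReal_sum]
    refine sum_congr rfl fun i hi => ?_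
    have hi' : i ≤ m := by rw [mem_range] at hi; omega
    rw [if_pos hi', inner_smul_left, inner_smul_right, inner_self_eq_norm_sq_to_K, hx _ hi',
      Complex.conj_ofReal]
    push_cast
    ring
  rw [e1, e2] at h3
  have h4 : (N : ℝ) * ∑ i ∈ range m, b i * b (i + 1) ≤
      N * (r * ∑ i ∈ range (m + 1), b i ^ 2) := by
    have f1 : ∀ a : ℝ, ((N : ℂ) * (a : ℂ)).re = N * a := by
      intro a; rw [← Complex.ofReal_natCast, ← Complex.ofReal_mul, Complex.ofReal_re]
    rw [f1, f1] at h3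
    linarith
  exact le_of_mul_le_mul_left h4 hN0

end RootsOfUnity

/-! ### Chebyshev values and tridiagonal forms -/

section ChebyshevRecurrence

open Finset

/-- The values at `r` of the Chebyshev polynomials of the second kind, shifted by one index. -/
def chebyshevSeq (r : ℝ) : ℕ → ℝ
  | 0 => 0
  | 1 => 1
  | j + 2 => 2 * r * chebyshevSeq r (j + 1) - chebyshevSeq r j

theorem chebyshevSeq_ne_zero_of_succ (r : ℝ) (j : ℕ) (h : chebyshevSeq r (j + 1) = 0) :
    chebyshevSeq r j ≠ 0 := by
  induction j with
  | zero => simp [chebyshevSeq] at h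
  | succ j ih =>
    intro h0
    apply ih h0
    rw [chebyshevSeq, h0] at h
    linarith

/-- The recurrence makes (u_1, ..., u_(j+1)) a null vector of the tridiagonal matrix with 2r on the
diagonal and -1 beside it, except in the last coordinate, where the residue is u_(j+2). -/
theorem chebyshevSeq_sum (r : ℝ) (j : ℕ) :
    2 * r * ∑ i ∈ range (j + 1), chebyshevSeq r (i + 1) ^ 2 -
      2 * ∑ i ∈ range j, chebyshevSeq r (i + 1) * chebyshevSeq r (i + 2) =
    chebyshevSeq r (j + 1) * chebyshevSeq r (j + 2) := by
  induction j with
  | zero => simp [chebyshevSeq]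
  | succ j ih =>
    rw [sum_range_succ (fun i => chebyshevSeq r (i + 1) ^ 2) (j + 1),
      sum_range_succ (fun i => chebyshevSeq r (i + 1) * chebyshevSeq r (i + 2)) j]
    rw [show chebyshevSeq r (j + 1 + 2) =
      2 * r * chebyshevSeq r (j + 1 + 1) - chebyshevSeq r (j + 1) from rfl]
    linear_combination ih

/-- A vanishing u_(j+2) makes the form zero at (u_1, ..., u_(j+1)). Appending a small entry ε
changes it by 2rε² - 2u_(j+1)ε, which takes negative values because u_(j+1) ≠ 0. -/
theorem chebyshevSeq_ne_zero (r : ℝ) (k : ℕ)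
    (h : ∀ m ≤ k, ∀ b : ℕ → ℝ,
      ∑ i ∈ range m, b i * b (i + 1) ≤ r * ∑ i ∈ range (m + 1), b i ^ 2)
    (j : ℕ) (hj : j ≤ k) : chebyshevSeq r (j + 1) ≠ 0 := by
  intro h0
  rcases j with _ | j
  · simp [chebyshevSeq] at h0
  set u := chebyshevSeq r with hu
  have hne := chebyshevSeq_ne_zero_of_succ r _ h0
  have key : ∀ ε : ℝ, 0 ≤ 2 * r * ε ^ 2 - 2 * (u (j + 1) * ε) := by
    intro ε
    have h1 := h (j + 1) hj (fun i => if i ≤ j then u (i + 1) else ε)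
    rw [sum_range_succ, sum_range_succ _ (j + 1)] at h1
    have e1 : ∑ i ∈ range j, ((if i ≤ j then u (i + 1) else ε) *
        if i + 1 ≤ j then u (i + 1 + 1) else ε) = ∑ i ∈ range j, u (i + 1) * u (i + 2) := by
      refine sum_congr rfl fun i hi => ?_
      rw [mem_range] at hi
      rw [if_pos hi.le, if_pos (by omega)]
    have e2 : ∑ i ∈ range (j + 1), (if i ≤ j then u (i + 1) else ε) ^ 2 =
        ∑ i ∈ range (j + 1), u (i + 1) ^ 2 := by
      refine sum_congr rfl fun i hi => ?_
      rw [mem_range] at hi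
      rw [if_pos (by omega)]
    rw [e1, e2] at h1
    simp only [le_refl, if_true, Nat.not_succ_le_self, if_false] at h1
    have h2 := chebyshevSeq_sum r j
    rw [← hu, show j + 2 = j + 1 + 1 from rfl, h0, mul_zero] at h2
    linarith
  set a := u (j + 1) with ha
  have hD : 0 < 2 * (|r| + 1) := by positivity
  -- This ε minimizes 2(|r| + 1)ε² - 2aε; using |r| + 1 avoids needing the sign of r.
  have h3 := key (a / (2 * (|r| + 1)))
  have h4 : 2 * r * (a / (2 * (|r| + 1))) ^ 2 ≤ 2 * (|r| + 1) * (a / (2 * (|r| + 1))) ^ 2 := by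
    gcongr
    linarith [le_abs_self r]
  have h5 : 2 * (|r| + 1) * (a / (2 * (|r| + 1))) ^ 2 = a ^ 2 / (2 * (|r| + 1)) := by
    field_simp
  have h6 : a * (a / (2 * (|r| + 1))) = a ^ 2 / (2 * (|r| + 1)) := by ring
  have h7 : 0 < a ^ 2 / (2 * (|r| + 1)) := div_pos (by positivity) hD
  rw [h6] at h3
  linarith

end ChebyshevRecurrence

/-! ### Schur complements along the kernels of powers -/

section KernelChain

open ContinuousLinearMap

variable {E : Type*} [NormedAddCommGroup E] [InnerProductSpace ℂ E]

/-- The kernel of `M ^ j`. -/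
def powKer (M : E →L[ℂ] E) (j : ℕ) : Submodule ℂ E :=
  LinearMap.ker ((M ^ j : E →L[ℂ] E) : E →ₗ[ℂ] E)

theorem mem_powKer {M : E →L[ℂ] E} {j : ℕ} {x : E} : x ∈ powKer M j ↔ (M ^ j) x = 0 := by
  simp only [powKer, LinearMap.mem_ker, ContinuousLinearMap.coe_coe]

theorem powKer_mono (M : E →L[ℂ] E) {i j : ℕ} (h : i ≤ j) : powKer M i ≤ powKer M j := by
  intro x hx
  rw [mem_powKer] at hx ⊢
  obtain ⟨d, rfl⟩ := Nat.exists_eq_add_of_le h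
  rw [add_comm, pow_add, mul_apply_eq_comp, hx, map_zero]

theorem map_mem_powKer {M : E →L[ℂ] E} {j : ℕ} {x : E} : M x ∈ powKer M j ↔ x ∈ powKer M (j + 1) := by
  rw [mem_powKer, mem_powKer, pow_succ, mul_apply_eq_comp]

variable [FiniteDimensional ℂ E]

theorem adjoint_mem_powKer_orthogonal {M : E →L[ℂ] E} {j : ℕ} {v : E} (hv : v ∈ (powKer M j)ᗮ) :
    adjoint M v ∈ (powKer M (j + 1))ᗮ := by
  rw [Submodule.mem_orthogonal] at hv ⊢
  intro w hw
  rw [adjoint_inner_right]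
  exact hv _ (map_mem_powKer.2 hw)

/-- The factorization says that M* maps ker M^j into ker M^(j+1); this is the dual statement. -/
theorem map_mem_powKer_orthogonal {M : E →L[ℂ] E} {j : ℕ}
    (h : ∃ L : E →L[ℂ] E, M ^ (j + 1) * adjoint M = L * M ^ j) {v : E}
    (hv : v ∈ (powKer M (j + 1))ᗮ) : M v ∈ (powKer M j)ᗮ := by
  obtain ⟨L, hL⟩ := h
  rw [Submodule.mem_orthogonal] at hv ⊢
  intro w hw
  rw [← adjoint_inner_left]
  refine hv _ ?_
  rw [mem_powKer, ← mul_apply_eq_comp, hL, mul_apply_eq_comp, mem_powKer.1 hw, map_zero]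

/-- For a partial isometry, M*M is the projection onto (ker M)ᗮ, which contains (ker M^(j+1))ᗮ. -/
theorem adjoint_map_eq_self {M : E →L[ℂ] E} (h : M * adjoint M * M = M) {j : ℕ} {v : E}
    (hv : v ∈ (powKer M (j + 1))ᗮ) : adjoint M (M v) = v := by
  have h1 : v ∈ (powKer M 1)ᗮ :=
    Submodule.orthogonal_le (powKer_mono M (by omega)) hv
  have h2 : adjoint M (M v) ∈ (powKer M 1)ᗮ := adjoint_mem_powKer_orthogonal (j := 0) (by
    rw [Submodule.mem_orthogonal]
    intro u hu
    rw [mem_powKer, pow_zero, one_apply_eq_self] at hu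
    rw [hu, inner_zero_left])
  have h3 : adjoint M (M v) - v ∈ powKer M 1 := by
    rw [mem_powKer, pow_one, map_sub, sub_eq_zero]
    exact congrArg (fun T : E →L[ℂ] E => T v) h
  exact sub_eq_zero.1 (inner_self_eq_zero.1 ((Submodule.mem_orthogonal _ _).1 (sub_mem h2 h1) _ h3))

/-- The compressed kernel equation on the orthogonal complement of `ker (M ^ j)`. -/
def KernelEq (M : E →L[ℂ] E) (a c : ℝ) (z : ℂ) (j : ℕ) (y : E) : Prop :=
  (((a - c : ℝ) : ℂ) • y - z • (powKer M j)ᗮ.starProjection (M y) -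
    (starRingEnd ℂ) z • adjoint M y +
    (c : ℂ) • adjoint M ((powKer M j)ᗮ.starProjection (M y))) = 0

/-- One Schur complement step. -/
theorem KernelEq.step {M : E →L[ℂ] E} {a c c' : ℝ} {z : ℂ} (hz : ‖z‖ = 1) {j : ℕ} {y : E}
    (hM : M * adjoint M * M = M)
    (hj : ∃ L : E →L[ℂ] E, M ^ (j + 1) * adjoint M = L * M ^ j)
    (hc : (a - c) * c' = 1) (hy : y ∈ (powKer M j)ᗮ) (hy0 : y ≠ 0) (h : KernelEq M a c z j y) :
    ∃ y' ∈ (powKer M (j + 1))ᗮ, y' ≠ 0 ∧ KernelEq M a c' z (j + 1) y' := by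
  -- The part `q` of y in ker M^(j+1) is the one to eliminate: PMq = 0, so it enters the equation
  -- only through the scalar a - c and through M*y. Its pivot inverse is c'.
  set P' := (powKer M (j + 1))ᗮ.starProjection with hP'
  set P := (powKer M j)ᗮ.starProjection with hP
  set y' := P' y with hy'
  set q := y - y' with hq
  have hy'R : y' ∈ (powKer M (j + 1))ᗮ := Submodule.starProjection_apply_mem _ _
  have hqK : q ∈ powKer M (j + 1) := by
    have := Submodule.sub_starProjection_mem_orthogonal (K := (powKer M (j + 1))ᗮ) y
    rwa [Submodule.orthogonal_orthogonal] at this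
  have hqR : q ∈ (powKer M j)ᗮ :=
    sub_mem hy (Submodule.orthogonal_le (powKer_mono M (by omega)) hy'R)
  have hyq : y = q + y' := by rw [hq]; abel
  clear_value q
  have hPq : P (M q) = 0 := by
    rw [hP, Submodule.starProjection_apply_eq_zero_iff, Submodule.orthogonal_orthogonal]
    exact map_mem_powKer.2 hqK
  have hPM : P (M y') = M y' :=
    Submodule.starProjection_eq_self_iff.2 (map_mem_powKer_orthogonal hj hy'R)
  have hMM : adjoint M (M y') = y' := adjoint_map_eq_self hM hy'R
  have hP'q : P' q = 0 := by
    rw [hP', Submodule.starProjection_apply_eq_zero_iff, Submodule.orthogonal_orthogonal]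
    exact hqK
  have hP'y' : P' y' = y' := Submodule.starProjection_eq_self_iff.2 hy'R
  have hP'a : P' (adjoint M y) = adjoint M y :=
    Submodule.starProjection_eq_self_iff.2 (adjoint_mem_powKer_orthogonal hy)
  have hzz : (starRingEnd ℂ) z * z = 1 := by
    rw [mul_comm, Complex.mul_conj, Complex.normSq_eq_norm_sq, hz]; simp
  have hcc : ((a : ℂ) - c) * c' = 1 := by exact_mod_cast hc
  have hPMy : P (M y) = M y' := by rw [hyq, map_add, map_add, hPq, zero_add, hPM]
  -- Since M*My' = y', the terms in c cancel on y' and leave the coefficient a.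
  have e1 : ((a : ℂ) - c) • q + (a : ℂ) • y' - z • M y' - (starRingEnd ℂ) z • adjoint M y = 0 := by
    have h1 := h
    rw [KernelEq, ← hP, hPMy, hMM] at h1
    rw [← h1]
    conv_rhs => enter [1, 1, 1, 2]; rw [hyq]
    push_cast
    module
  have e2 : (a : ℂ) • y' - z • P' (M y') - (starRingEnd ℂ) z • adjoint M y = 0 := by
    have h1 := congrArg P' e1
    simpa only [map_add, map_sub, map_smul, hP'q, hP'y', hP'a, smul_zero, zero_add, map_zero] using h1
  have e3 : q = (c' : ℂ) • z • (M y' - P' (M y')) := by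
    have h1 : ((a : ℂ) - c) • q = z • (M y' - P' (M y')) := by
      have h2 := e1.trans e2.symm
      rw [smul_sub]
      rw [← sub_eq_zero] at h2 ⊢
      rw [← h2]
      module
    rw [← h1, smul_smul, mul_comm, hcc, one_smul]
  refine ⟨y', hy'R, ?_, ?_⟩
  · intro h0
    apply hy0
    rw [hyq, e3, h0]
    simp
  · rw [KernelEq, ← hP']
    have e4 : (starRingEnd ℂ) z • adjoint M q = (c' : ℂ) • (y' - adjoint M (P' (M y'))) := by
      rw [e3, map_smul, map_smul, map_sub, hMM, smul_comm, smul_smul ((starRingEnd ℂ) z), hzz,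
        one_smul]
    have e5 : (starRingEnd ℂ) z • adjoint M y =
        (c' : ℂ) • (y' - adjoint M (P' (M y'))) + (starRingEnd ℂ) z • adjoint M y' := by
      rw [← e4, ← smul_add, ← map_add, ← hyq]
    rw [e5] at e2
    rw [← e2]
    push_cast
    module

/-- A nonzero vector in a positive semidefinite form's null cone is annihilated. -/
theorem apply_eq_zero_of_inner_eq_zero {G : E →L[ℂ] E} (hG : adjoint G = G)
    (hpos : ∀ y, 0 ≤ (inner ℂ y (G y)).re) {y : E} (hy : (inner ℂ y (G y)).re = 0) : G y = 0 := by
  by_contra hne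
  set w := G y with hw
  have hw0 : 0 < ‖w‖ ^ 2 := by positivity
  have key : ∀ t : ℝ, 0 ≤ t ^ 2 * (inner ℂ w (G w)).re - 2 * t * ‖w‖ ^ 2 := by
    intro t
    have h := hpos (y - (t : ℂ) • w)
    have h1 : inner ℂ y (G w) = inner ℂ w w := by
      rw [← adjoint_inner_left, hG]
    have h2 : inner ℂ w w = ((‖w‖ ^ 2 : ℝ) : ℂ) := by
      rw [inner_self_eq_norm_sq_to_K]; norm_cast
    rw [map_sub, map_smul, inner_sub_left, inner_sub_right, inner_sub_right, inner_smul_left,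
      inner_smul_left, inner_smul_right, inner_smul_right, ← hw, h1, h2, Complex.conj_ofReal] at h
    simp only [Complex.sub_re, Complex.re_ofReal_mul, Complex.ofReal_re, hy] at h
    linarith
  set b := (inner ℂ w (G w)).re with hb
  have hb0 : 0 ≤ b := hpos w
  have h := key (‖w‖ ^ 2 / (b + 1))
  have e : (‖w‖ ^ 2 / (b + 1)) ^ 2 * b - 2 * (‖w‖ ^ 2 / (b + 1)) * ‖w‖ ^ 2 =
      - ((‖w‖ ^ 2) ^ 2 * (b + 2) / (b + 1) ^ 2) := by
    field_simp
    ring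
  rw [e] at h
  have : 0 < (‖w‖ ^ 2) ^ 2 * (b + 2) / (b + 1) ^ 2 := by positivity
  linarith

/-- A polynomial family of operators that is singular on the unit circle is singular at `0`. -/
theorem exists_apply_eq_zero_of_circle (A B C : E →L[ℂ] E)
    (h : ∀ z : ℂ, ‖z‖ = 1 → ∃ y ≠ 0, (A + z • B + z ^ 2 • C) y = 0) :
    ∃ y ≠ 0, A y = 0 := by
  classical
  let b := (stdOrthonormalBasis ℂ E).toBasis
  let m := fun T : E →L[ℂ] E => LinearMap.toMatrix b b (T : E →ₗ[ℂ] E)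
  have hm : ∀ T : E →L[ℂ] E, (m T).det = 0 ↔ ∃ y ≠ 0, T y = 0 := by
    intro T
    rw [LinearMap.det_toMatrix, LinearMap.det_eq_zero_iff_ker_ne_bot, Submodule.ne_bot_iff]
    constructor
    · rintro ⟨y, hy, h0⟩; exact ⟨y, h0, hy⟩
    · rintro ⟨y, h0, hy⟩; exact ⟨y, hy, h0⟩
  -- The determinant of this matrix pencil is a polynomial in z; vanishing on the infinite unit
  -- circle makes it zero.
  let F : Matrix _ _ (Polynomial ℂ) :=
    (m A).map Polynomial.C + (Polynomial.X : Polynomial ℂ) • (m B).map Polynomial.C +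
      (Polynomial.X ^ 2 : Polynomial ℂ) • (m C).map Polynomial.C
  have hF : ∀ z : ℂ, F.det.eval z = (m (A + z • B + z ^ 2 • C)).det := by
    intro z
    rw [← Polynomial.coe_evalRingHom, RingHom.map_det]
    congr 1
    ext i j
    simp [F, m]
    ring
  have hzero : F.det = 0 := by
    refine Polynomial.eq_zero_of_infinite_isRoot _ (Set.Infinite.mono (s := {z : ℂ | ‖z‖ = 1}) ?_ ?_)
    · intro z hz
      change F.det.IsRoot z
      rw [Polynomial.IsRoot.def, hF, hm]
      exact h z hz
    · have : {z : ℂ | ‖z‖ = 1} = Metric.sphere (0 : ℂ) 1 := by ext; simp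
      rw [this]
      refine (isPreconnected_sphere (by rw [Complex.rank_real_complex]; norm_num) _ _).infinite_of_nontrivial ?_
      exact ⟨1, by simp, -1, by simp, by norm_num⟩
  rw [← hm]
  have := hF 0
  rw [hzero] at this
  simpa using this.symm

theorem exists_adjoint_apply_eq_zero {A : E →L[ℂ] E} (h : ∃ y ≠ 0, A y = 0) :
    ∃ y ≠ 0, adjoint A y = 0 := by
  obtain ⟨v, hv0, hv⟩ := h
  by_contra! hA
  have hinj : Function.Injective (adjoint A : E →ₗ[ℂ] E) := by
    rw [injective_iff_map_eq_zero]
    intro y hy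
    by_contra hne
    exact hA y hne hy
  obtain ⟨w, hw⟩ := LinearMap.injective_iff_surjective.1 hinj v
  apply hv0
  rw [← inner_self_eq_zero (𝕜 := ℂ)]
  nth_rewrite 2 [← hw]
  rw [ContinuousLinearMap.coe_coe, adjoint_inner_right, hv, inner_zero_left]

/-- M is isometric on (ker M^(j+1))ᗮ and maps it into (ker M^j)ᗮ, so k steps preserve the norm. -/
theorem norm_pow_apply_of_mem_powKer_orthogonal {M : E →L[ℂ] E} {k : ℕ}
    (hM : 0 < k → M * adjoint M * M = M)
    (hpow : ∀ j < k, ∃ L : E →L[ℂ] E, M ^ (j + 1) * adjoint M = L * M ^ j) {x : E}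
    (hxR : x ∈ (powKer M k)ᗮ) (hx1 : ‖x‖ = 1) :
    ∀ i ≤ k, ‖(M ^ i) x‖ = 1 ∧ (M ^ i) x ∈ (powKer M (k - i))ᗮ := by
  intro i
  induction i with
  | zero => intro _; simpa using ⟨hx1, hxR⟩
  | succ i ih =>
    intro hi
    obtain ⟨h1, h2⟩ := ih (by omega)
    have h3 : k - i = (k - (i + 1)) + 1 := by omega
    rw [h3] at h2
    rw [pow_succ', mul_apply_eq_comp]
    refine ⟨?_, map_mem_powKer_orthogonal (hpow _ (by omega)) h2⟩
    have h4 : (‖M ((M ^ i) x)‖ : ℂ) ^ 2 = (‖(M ^ i) x‖ : ℂ) ^ 2 := by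
      have e1 := inner_self_eq_norm_sq_to_K (𝕜 := ℂ) (M ((M ^ i) x))
      have e2 := inner_self_eq_norm_sq_to_K (𝕜 := ℂ) ((M ^ i) x)
      rw [← adjoint_inner_left, adjoint_map_eq_self (hM (by omega)) h2, e2] at e1
      exact e1.symm
    rw [h1] at h4
    have h5 : ‖M ((M ^ i) x)‖ ^ 2 = 1 ^ 2 := by exact_mod_cast h4
    exact (sq_eq_sq₀ (norm_nonneg _) zero_le_one).1 h5

theorem exists_unit_mem_orthogonal {K : Submodule ℂ E} (hK : K ≠ ⊤) : ∃ x ∈ Kᗮ, ‖x‖ = 1 := by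
  have hbot : Kᗮ ≠ ⊥ := by rwa [Ne, Submodule.orthogonal_eq_bot_iff]
  obtain ⟨x, hx, hx0⟩ := Submodule.exists_mem_ne_zero_of_ne_bot hbot
  refine ⟨((‖x‖⁻¹ : ℝ) : ℂ) • x, Submodule.smul_mem _ _ hx, ?_⟩
  rw [norm_smul, Complex.norm_real, norm_inv, norm_norm, inv_mul_cancel₀ (norm_ne_zero_iff.2 hx0)]

/-- If `M` has constant maximal rotated real part `r` and acts as a power partial isometry up to
level `k`, then the kernels of its powers cannot stabilise at level `k` unless `M ^ k = 0`. -/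
theorem pow_eq_zero_of_ker_pow_stable (M : E →L[ℂ] E) (r : ℝ) (k : ℕ)
    (hle : ∀ z : ℂ, ‖z‖ = 1 → ∀ y : E, (z * inner ℂ y (M y)).re ≤ r * ‖y‖ ^ 2)
    (heq : ∀ z : ℂ, ‖z‖ = 1 → ∃ y : E, y ≠ 0 ∧
      ((2 * r : ℝ) : ℂ) • y - z • M y - (starRingEnd ℂ) z • adjoint M y = 0)
    (hM : 0 < k → M * adjoint M * M = M)
    (hpow : ∀ j < k, ∃ L : E →L[ℂ] E, M ^ (j + 1) * adjoint M = L * M ^ j)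
    (hstable : ∃ L : E →L[ℂ] E, M ^ k = L * M ^ (k + 1)) : M ^ k = 0 := by
  by_contra hne
  obtain ⟨x, hxR, hx1⟩ := exists_unit_mem_orthogonal (K := powKer M k) (by
    intro h
    apply hne
    ext x
    exact mem_powKer.1 (h ▸ Submodule.mem_top))
  have hchain := norm_pow_apply_of_mem_powKer_orthogonal hM hpow hxR hx1
  have hu : ∀ j ≤ k, chebyshevSeq r (j + 1) ≠ 0 :=
    chebyshevSeq_ne_zero r k fun m hm =>
      tridiagonal_form_le M r hle m x fun i hi => (hchain i (hi.trans hm)).1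
  -- These ratios solve c_0 = 0, c_(j+1) = 1 / (2r - c_j), the recursion of the Schur complements.
  set c : ℕ → ℝ := fun j => chebyshevSeq r j / chebyshevSeq r (j + 1) with hc
  have hstep : ∀ z : ℂ, ‖z‖ = 1 → ∀ j ≤ k, ∃ y ∈ (powKer M j)ᗮ, y ≠ 0 ∧
      KernelEq M (2 * r) (c j) z j y := by
    intro z hz j
    induction j with
    | zero =>
      intro _
      obtain ⟨y, hy0, hy⟩ := heq z hz
      have h0 : ∀ v, v ∈ (powKer M 0)ᗮ := by
        intro v
        rw [Submodule.mem_orthogonal]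
        intro u hu
        rw [mem_powKer, pow_zero, one_apply_eq_self] at hu
        rw [hu, inner_zero_left]
      refine ⟨y, h0 y, hy0, ?_⟩
      have hc0 : c 0 = 0 := by simp [hc, chebyshevSeq]
      rw [KernelEq, hc0, Submodule.starProjection_eq_self_iff.2 (h0 _), sub_zero, hy]
      simp
    | succ j ih =>
      intro hj
      obtain ⟨y, hyR, hy0, hy⟩ := ih (by omega)
      refine hy.step hz (hM (by omega)) (hpow j (by omega)) ?_ hyR hy0
      have h1 := hu j (by omega)
      have h2 := hu (j + 1) hj
      simp only [hc]
      rw [show chebyshevSeq r (j + 1 + 1) =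
        2 * r * chebyshevSeq r (j + 1) - chebyshevSeq r j from rfl] at h2 ⊢
      field_simp
  set P := (powKer M k)ᗮ.starProjection with hP
  have hPa : adjoint P = P := by
    rw [← star_eq_adjoint]
    exact isSelfAdjoint_starProjection _
  -- Multiplying the kernel equation by z removes z̄. The extra 1 - P kills y, and prevents the
  -- constant term from being singular merely because P is not the identity.
  have hsing := exists_apply_eq_zero_of_circle ((1 - P) - adjoint M * P)
    (((2 * r - c k : ℝ) : ℂ) • 1 + (c k : ℂ) • (adjoint M * P * M)) (-(P * M)) (by
      intro z hz
      obtain ⟨y, hyR, hy0, hy⟩ := hstep z hz k le_rfl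
      refine ⟨y, hy0, ?_⟩
      have hzz : z * (starRingEnd ℂ) z = 1 := by
        rw [Complex.mul_conj, Complex.normSq_eq_norm_sq, hz]; simp
      have hPy : P y = y := Submodule.starProjection_eq_self_iff.2 hyR
      rw [KernelEq, ← hP] at hy
      have h1 := congrArg (fun v => z • v) hy
      simp only [smul_add, smul_sub, smul_zero, smul_smul z ((starRingEnd ℂ) z), hzz, one_smul] at h1
      rw [← h1]
      simp only [add_apply, sub_apply, smul_apply, neg_apply, mul_apply_eq_comp, one_apply_eq_self,
        hPy]
      module)
  obtain ⟨h, hh0, hh⟩ := exists_adjoint_apply_eq_zero hsing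
  have hadj : adjoint ((1 - P) - adjoint M * P) = (1 - P) - P * M := by
    simp only [← star_eq_adjoint] at hPa ⊢
    simp only [star_sub, star_one, star_mul, star_star, hPa]
  rw [hadj] at hh
  -- The two sides lie in orthogonal subspaces, so both vanish.
  have h1 : (h - P h) = P (M h) := by
    rw [← sub_eq_zero]; exact hh
  have hPP : ∀ v, P (P v) = P v := fun v =>
    Submodule.starProjection_eq_self_iff.2 (Submodule.starProjection_apply_mem _ _)
  have h2 : P (M h) = 0 := by
    have := congrArg P h1
    rw [map_sub, hPP, sub_self, hPP] at this
    exact this.symm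
  rw [h2, sub_eq_zero] at h1
  have hhR : h ∈ (powKer M k)ᗮ := Submodule.starProjection_eq_self_iff.1 h1.symm
  have hMh : M h ∈ powKer M k := by
    rw [hP, Submodule.starProjection_apply_eq_zero_iff, Submodule.orthogonal_orthogonal] at h2
    exact h2
  have hhK : h ∈ powKer M k := by
    obtain ⟨L, hL⟩ := hstable
    rw [mem_powKer, hL, mul_apply_eq_comp, mem_powKer.1 (map_mem_powKer.1 hMh), map_zero]
  exact hh0 (inner_self_eq_zero.1 ((Submodule.mem_orthogonal _ _).1 hhR _ hhK))

end KernelChain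

/-! ### Kernel growth in star algebras and Kronecker squares -/

section PowKernelGrowth

/-- As long as `a` behaves like a power partial isometry up to level `k`, the left annihilation
relation of `a ^ (k + 1)` is strictly weaker than that of `a ^ k`, unless `a ^ k = 0`. -/
def HasPowKernelGrowth {R : Type*} [Ring R] [StarRing R] (a : R) : Prop :=
  ∀ k : ℕ, (0 < k → a * star a * a = a) →
    (∀ j < k, ∃ L : R, a ^ (j + 1) * star a = L * a ^ j) →
    (∃ L : R, a ^ k = L * a ^ (k + 1)) → a ^ k = 0

theorem HasPowKernelGrowth.map {R S : Type*} [Ring R] [StarRing R] [Algebra ℂ R] [Ring S]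
    [StarRing S] [Algebra ℂ S] (φ : R ≃⋆ₐ[ℂ] S) {a : R} (h : HasPowKernelGrowth a) :
    HasPowKernelGrowth (φ a) := by
  intro k h1 h2 h3
  rw [← map_pow, h k, map_zero]
  · intro hk
    apply EquivLike.injective φ
    simpa [map_star] using h1 hk
  · intro j hj
    obtain ⟨L, hL⟩ := h2 j hj
    refine ⟨φ.symm L, EquivLike.injective φ ?_⟩
    simpa [map_star, StarAlgEquiv.apply_symm_apply] using hL
  · obtain ⟨L, hL⟩ := h3
    refine ⟨φ.symm L, EquivLike.injective φ ?_⟩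
    simpa [map_star, StarAlgEquiv.apply_symm_apply] using hL

theorem kronecker_self_pow {ι : Type*} [Fintype ι] [DecidableEq ι] (A : Matrix ι ι ℂ) (k : ℕ) :
    (A ⊗ₖ A) ^ k = (A ^ k) ⊗ₖ (A ^ k) := by
  induction k with
  | zero => simp
  | succ k ih => rw [pow_succ, ih, ← Matrix.mul_kronecker_mul, ← pow_succ]

/-- Each relation for A gives one for A ⊗ A with multiplier L ⊗ L. Squares of the entries of A^k
occur among the entries of A^k ⊗ A^k, so the latter vanishes only if A^k does. -/
theorem HasPowKernelGrowth.of_kronecker_self {ι : Type*} [Fintype ι] [DecidableEq ι]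
    {A : Matrix ι ι ℂ} (h : HasPowKernelGrowth (A ⊗ₖ A)) : HasPowKernelGrowth A := by
  have hs : star (A ⊗ₖ A) = star A ⊗ₖ star A := Matrix.conjTranspose_kronecker A A
  intro k h1 h2 h3
  have h0 : (A ^ k) ⊗ₖ (A ^ k) = 0 := by
    rw [← kronecker_self_pow]
    refine h k ?_ ?_ ?_
    · intro hk
      rw [hs, ← Matrix.mul_kronecker_mul, ← Matrix.mul_kronecker_mul, h1 hk]
    · intro j hj
      obtain ⟨L, hL⟩ := h2 j hj
      refine ⟨L ⊗ₖ L, ?_⟩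
      rw [hs, kronecker_self_pow, kronecker_self_pow, ← Matrix.mul_kronecker_mul,
        ← Matrix.mul_kronecker_mul, hL]
    · obtain ⟨L, hL⟩ := h3
      refine ⟨L ⊗ₖ L, ?_⟩
      rw [kronecker_self_pow, kronecker_self_pow, ← Matrix.mul_kronecker_mul, ← hL]
  ext i j
  have := congrFun (congrFun h0 (i, i)) (j, j)
  simpa using this

end PowKernelGrowth

/-! ### From a circular numerical range to kernel growth -/

section NumericalRange

open ContinuousLinearMap Matrix

variable {ι : Type*} [Fintype ι] [DecidableEq ι]

theorem hasPowKernelGrowth_of_isDiscAtOrigin {A : Matrix ι ι ℂ}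
    (h : IsDiscAtOrigin (numericalRange A)) : HasPowKernelGrowth A := by
  obtain ⟨r, hr0, hr⟩ := h
  set M := toEuclideanCLM (𝕜 := ℂ) A with hM
  have hbound : ∀ y, ‖inner ℂ y (M y)‖ ≤ r * ‖y‖ ^ 2 := by
    intro y
    rcases eq_or_ne y 0 with rfl | hy
    · simp
    have hy' : ‖y‖ ≠ 0 := norm_ne_zero_iff.2 hy
    set x := ((‖y‖⁻¹ : ℝ) : ℂ) • y with hx
    have hx1 : ‖x‖ = 1 := by
      rw [hx, norm_smul, Complex.norm_real, norm_inv, norm_norm, inv_mul_cancel₀ hy']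
    have h1 : inner ℂ x (M x) ∈ numericalRange A := ⟨x, hx1, rfl⟩
    rw [hr, mem_closedBall_zero_iff] at h1
    have h2 : y = (‖y‖ : ℂ) • x := by
      rw [hx, smul_smul]
      push_cast
      rw [mul_inv_cancel₀ (by exact_mod_cast hy'), one_smul]
    rw [h2, map_smul, inner_smul_left, inner_smul_right, norm_mul, norm_mul, norm_smul, hx1]
    simp only [Complex.conj_ofReal, Complex.norm_real, norm_norm, mul_one]
    nlinarith [norm_nonneg y, mul_le_mul_of_nonneg_left h1 (mul_nonneg (norm_nonneg y) (norm_nonneg y))]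
  have hle : ∀ z : ℂ, ‖z‖ = 1 → ∀ y, (z * inner ℂ y (M y)).re ≤ r * ‖y‖ ^ 2 := by
    intro z hz y
    refine (Complex.re_le_norm _).trans ?_
    rw [norm_mul, hz, one_mul]
    exact hbound y
  have heq : ∀ z : ℂ, ‖z‖ = 1 → ∃ y, y ≠ 0 ∧
      ((2 * r : ℝ) : ℂ) • y - z • M y - (starRingEnd ℂ) z • adjoint M y = 0 := by
    intro z hz
    -- At the boundary point z̄r the bound Re(z⟨My, y⟩) ≤ r‖y‖² is attained, so the positive form of
    -- `G` has a null vector.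
    have hmem : (starRingEnd ℂ) z * r ∈ numericalRange A := by
      rw [hr, mem_closedBall_zero_iff, norm_mul, RCLike.norm_conj, hz, one_mul, Complex.norm_real,
        Real.norm_of_nonneg hr0]
    obtain ⟨x, hx1, hx⟩ := hmem
    set G := ((2 * r : ℝ) : ℂ) • (1 : EuclideanSpace ℂ ι →L[ℂ] _) - z • M -
      (starRingEnd ℂ) z • adjoint M with hG
    have hform : ∀ y, (inner ℂ y (G y)).re = 2 * (r * ‖y‖ ^ 2 - (z * inner ℂ y (M y)).re) := by
      intro y
      have e1 : inner ℂ y (adjoint M y) = (starRingEnd ℂ) (inner ℂ y (M y)) := by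
        rw [adjoint_inner_right, inner_conj_symm]
      have e2 : inner ℂ y y = ((‖y‖ ^ 2 : ℝ) : ℂ) := by
        rw [inner_self_eq_norm_sq_to_K]; norm_cast
      have e3 : inner ℂ y (G y) = ((2 * r : ℝ) : ℂ) * ((‖y‖ ^ 2 : ℝ) : ℂ) - z * inner ℂ y (M y) -
          (starRingEnd ℂ) (z * inner ℂ y (M y)) := by
        simp only [hG, _root_.sub_apply, _root_.smul_apply, one_apply_eq_self, inner_sub_right, inner_smul_right,
          e1, e2, map_mul]
      rw [e3, Complex.sub_re, Complex.sub_re, Complex.conj_re, Complex.re_ofReal_mul,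
        Complex.ofReal_re]
      ring
    have hGa : adjoint G = G := by
      rw [hG]
      simp only [← star_eq_adjoint, star_sub, star_smul, star_one, star_star, Complex.star_def,
        Complex.conj_ofReal, Complex.conj_conj]
      abel
    have hx0 : x ≠ 0 := by rintro rfl; simp at hx1
    refine ⟨x, hx0, ?_⟩
    refine apply_eq_zero_of_inner_eq_zero hGa (fun y => ?_) (y := x) ?_
    · rw [hform]; linarith [hle z hz y]
    · rw [← hM] at hx
      rw [hform, ← hx, hx1, ← mul_assoc, Complex.mul_conj, Complex.normSq_eq_norm_sq, hz]
      simp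
  have hgrow : HasPowKernelGrowth M := fun k h1 h2 h3 =>
    pow_eq_zero_of_ker_pow_stable M r k hle heq h1 h2 h3
  have := hgrow.map (toEuclideanCLM (𝕜 := ℂ) (n := ι)).symm
  rwa [hM, StarAlgEquiv.symm_apply_apply] at this

end NumericalRange

/-! ### Rank-one defect and the Jordan chain -/

section DefectOne

open ContinuousLinearMap

variable {E : Type*} [NormedAddCommGroup E] [InnerProductSpace ℂ E] [FiniteDimensional ℂ E]

/-- T descends to E / ker S ≅ range S and extends from there to E. This turns kernel inclusions into
the factorizations of `HasPowKernelGrowth`. -/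
theorem exists_eq_mul_of_ker_le (S T : E →L[ℂ] E) (h : ∀ x, S x = 0 → T x = 0) :
    ∃ L : E →L[ℂ] E, T = L * S := by
  let f : LinearMap.range (S : E →ₗ[ℂ] E) →ₗ[ℂ] E :=
    (LinearMap.ker (S : E →ₗ[ℂ] E)).liftQ (T : E →ₗ[ℂ] E) (fun x hx => h x hx) ∘ₗ
      ((S : E →ₗ[ℂ] E).quotKerEquivRange.symm : _ →ₗ[ℂ] _)
  obtain ⟨g, hg⟩ := LinearMap.exists_extend f
  refine ⟨LinearMap.toContinuousLinearMap g, ?_⟩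
  ext x
  have h1 := LinearMap.congr_fun hg ⟨S x, ⟨x, rfl⟩⟩
  have h2 : (S : E →ₗ[ℂ] E).quotKerEquivRange.symm ⟨S x, ⟨x, rfl⟩⟩ =
      (LinearMap.ker (S : E →ₗ[ℂ] E)).mkQ x := by
    rw [LinearEquiv.symm_apply_eq]
    rfl
  simp only [f, LinearMap.comp_apply, LinearEquiv.coe_coe, h2] at h1
  exact h1.symm

theorem finrank_powKer_succ_le (T : E →L[ℂ] E) (j : ℕ) :
    Module.finrank ℂ (powKer T (j + 1)) ≤
      Module.finrank ℂ ((powKer T (j + 1)).map (T : E →ₗ[ℂ] E)) +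
        Module.finrank ℂ (powKer T 1) := by
  have h := ((T : E →ₗ[ℂ] E).domRestrict (powKer T (j + 1))).finrank_range_add_finrank_ker
  rw [LinearMap.range_domRestrict] at h
  rw [← h]
  gcongr
  refine LinearMap.finrank_le_finrank_of_injective
    (f := ((powKer T (j + 1)).subtype.domRestrict _).codRestrict (powKer T 1) ?_) ?_
  · rintro ⟨x, hx⟩
    rw [mem_powKer, pow_one]
    exact hx
  · intro x y hxy
    have := congrArg Subtype.val hxy
    exact Subtype.ext (Subtype.ext this)

/-- A singular operator whose defect `1 - T* T` has rank at most one is a partial isometry with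
one-dimensional kernel. -/
theorem isPartialIsometry_of_defect {T : E →L[ℂ] E} (hD : ∃ v : E, ∀ x, ∃ a : ℂ, x - adjoint T (T x) = a • v)
    (hT : powKer T 1 ≠ ⊥) :
    T * adjoint T * T = T ∧ Module.finrank ℂ (powKer T 1) = 1 := by
  obtain ⟨v, hv⟩ := hD
  obtain ⟨w, hw, hw0⟩ := Submodule.exists_mem_ne_zero_of_ne_bot hT
  have hker : ∀ u, u ∈ powKer T 1 ↔ T u = 0 := fun u => by rw [mem_powKer, pow_one]
  rw [hker] at hw
  -- The kernel vector w equals its own defect, so it spans the defect range and can replace v.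
  have hw' : ∀ x, ∃ a : ℂ, x - adjoint T (T x) = a • w := by
    obtain ⟨b, hb⟩ := hv w
    rw [hw, map_zero, sub_zero] at hb
    have hb0 : b ≠ 0 := by
      rintro rfl
      exact hw0 (by rw [hb, zero_smul])
    intro x
    obtain ⟨a, ha⟩ := hv x
    refine ⟨a * b⁻¹, ?_⟩
    rw [ha, hb, smul_smul, mul_assoc, inv_mul_cancel₀ hb0, mul_one]
  constructor
  · ext x
    obtain ⟨a, ha⟩ := hw' x
    have := congrArg T ha
    rw [map_sub, map_smul, hw, smul_zero, sub_eq_zero] at this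
    exact this.symm
  · refine finrank_eq_one (⟨w, (hker w).2 hw⟩ : powKer T 1) ?_ ?_
    · intro h; exact hw0 (congrArg Subtype.val h)
    · rintro ⟨u, hu⟩
      obtain ⟨a, ha⟩ := hw' u
      rw [(hker u).1 hu, map_zero, sub_zero] at ha
      exact ⟨a, Subtype.ext ha.symm⟩

/-- Growth makes the kernel increase at each level, and nullity one limits the increase to one.
Counting dimensions, T maps ker T^(j+1) onto ker T^j; writing y = Tw there, T^(j+1)T*y = T^(j+1)w =
0 supplies the next factorization. -/
theorem finrank_powKer_of_growth {T : E →L[ℂ] E}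
    (hD : ∃ v : E, ∀ x, ∃ a : ℂ, x - adjoint T (T x) = a • v) (hG : HasPowKernelGrowth T) :
    ∀ k ≤ Module.finrank ℂ E, (0 < k → T * adjoint T * T = T) ∧
      (∀ j < k, ∃ L : E →L[ℂ] E, T ^ (j + 1) * adjoint T = L * T ^ j) ∧
      ∀ j ≤ k, Module.finrank ℂ (powKer T j) = j := by
  have hK0 : powKer T 0 = ⊥ := by
    ext x; rw [mem_powKer, pow_zero, one_apply_eq_self, Submodule.mem_bot]
  intro k
  induction k with
  | zero =>
    intro _
    refine ⟨fun h => absurd h (lt_irrefl _), fun j hj => absurd hj (Nat.not_lt_zero _), ?_⟩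
    intro j hj
    obtain rfl : j = 0 := by omega
    rw [hK0, finrank_bot]
  | succ k ih =>
    intro hk
    obtain ⟨h1, h2, h3⟩ := ih (by omega)
    have hne : powKer T k ≠ powKer T (k + 1) := by
      intro heq
      have h0 : T ^ k = 0 := by
        refine hG k h1 h2 (exists_eq_mul_of_ker_le _ _ fun x hx => ?_)
        rw [← mem_powKer, heq, mem_powKer]
        exact hx
      have htop : powKer T k = ⊤ := by
        rw [eq_top_iff]
        intro x _
        rw [mem_powKer, h0]
        rfl
      have := h3 k le_rfl
      rw [htop, finrank_top] at this
      omega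
    have hlt : powKer T k < powKer T (k + 1) := lt_of_le_of_ne (powKer_mono T (Nat.le_succ k)) hne
    have hsing : powKer T 1 ≠ ⊥ := by
      intro hbot
      apply hne
      have h4 := finrank_powKer_succ_le T k
      refine le_antisymm (powKer_mono T (Nat.le_succ k)) ?_
      have hinj : ∀ u, T u = 0 → u = 0 := fun u hu => by
        rw [← Submodule.mem_bot (R := ℂ), ← hbot, mem_powKer, pow_one]; exact hu
      have hinj' : ∀ i u, (T ^ i) u = 0 → u = 0 := by
        intro i
        induction i with
        | zero => intro u hu; simpa using hu
        | succ i ihi =>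
          intro u hu
          rw [pow_succ, mul_apply_eq_comp] at hu
          exact hinj _ (ihi _ hu)
      intro x hx
      rw [hinj' _ x (mem_powKer.1 hx)]
      exact zero_mem _
    obtain ⟨hpi, hone⟩ := isPartialIsometry_of_defect hD hsing
    have hmap : ∀ j, (powKer T (j + 1)).map (T : E →ₗ[ℂ] E) ≤ powKer T j := by
      rintro j _ ⟨x, hx, rfl⟩
      exact map_mem_powKer.2 hx
    have hdim : ∀ j ≤ k + 1, Module.finrank ℂ (powKer T j) = j := by
      intro j hj
      rcases Nat.lt_or_ge k j with hkj | hkj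
      · obtain rfl : j = k + 1 := by omega
        have h4 := finrank_powKer_succ_le T k
        have h5 := Submodule.finrank_mono (hmap k)
        have h6 := Submodule.finrank_lt_finrank_of_lt hlt
        rw [h3 k le_rfl] at h5 h6
        omega
      · exact h3 j hkj
    refine ⟨fun _ => hpi, fun j hj => exists_eq_mul_of_ker_le _ _ fun y hy => ?_, hdim⟩
    have h4 : (powKer T (j + 1)).map (T : E →ₗ[ℂ] E) = powKer T j := by
      refine Submodule.eq_of_le_of_finrank_le (hmap j) ?_
      have := finrank_powKer_succ_le T j
      rw [hdim j (by omega)]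
      rw [hdim (j + 1) (by omega)] at this
      omega
    obtain ⟨w, hw, rfl⟩ : y ∈ (powKer T (j + 1)).map (T : E →ₗ[ℂ] E) := by
      rw [h4, mem_powKer]; exact hy
    rw [mul_apply_eq_comp, ContinuousLinearMap.coe_coe, pow_succ, mul_apply_eq_comp]
    have h5 : T (adjoint T (T w)) = T w := congrArg (fun S : E →L[ℂ] E => S w) hpi
    rw [h5, ← mul_apply_eq_comp, ← pow_succ]
    exact mem_powKer.1 hw

/-- Rank-one defect together with kernel growth forces a single Jordan chain of orthonormal
vectors. -/
theorem exists_orthonormal_chain {n : ℕ} (hn : Module.finrank ℂ E = n) {T : E →L[ℂ] E}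
    (hD : ∃ v : E, ∀ x, ∃ a : ℂ, x - adjoint T (T x) = a • v) (hG : HasPowKernelGrowth T) :
    ∃ e : Fin n → E, Orthonormal ℂ e ∧ ∀ i, T (e i) = ∑ l, jordanBlock n l i • e l := by
  rcases Nat.eq_zero_or_pos n with rfl | hpos
  · exact ⟨fun i => i.elim0, ⟨fun i => i.elim0, fun i => i.elim0⟩, fun i => i.elim0⟩
  obtain ⟨h1, h2, h3⟩ := finrank_powKer_of_growth hD hG n hn.ge
  obtain ⟨x, hxR, hx1⟩ := exists_unit_mem_orthogonal (K := powKer T (n - 1)) (by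
    intro h
    have := h3 (n - 1) (by omega)
    rw [h, finrank_top] at this
    omega)
  have hchain := norm_pow_apply_of_mem_powKer_orthogonal (fun _ => h1 hpos)
    (fun j hj => h2 j (by omega)) hxR hx1
  have htop : powKer T n = ⊤ := Submodule.eq_top_of_finrank_eq (by rw [h3 n le_rfl, hn])
  have hTn : (T ^ n) x = 0 := by rw [← mem_powKer, htop]; exact Submodule.mem_top
  -- Reversed order puts the ones on the superdiagonal: T e_i = e_(i-1). For i < l, e_i lies in ker
  -- T^(i+1) ⊆ ker T^l, while e_l is orthogonal to ker T^l.
  refine ⟨fun i => (T ^ (n - 1 - i)) x, ⟨fun i => (hchain _ (by omega)).1, ?_⟩, ?_⟩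
  · have key : ∀ i l : Fin n, i < l →
        inner ℂ ((T ^ (n - 1 - i)) x) ((T ^ (n - 1 - l)) x) = 0 := by
      intro i l hil
      have hl := (hchain (n - 1 - l) (by omega)).2
      rw [show n - 1 - (n - 1 - (l : ℕ)) = l by omega] at hl
      refine (Submodule.mem_orthogonal _ _).1 hl _ ?_
      refine powKer_mono T (show (i : ℕ) + 1 ≤ l by exact hil) ?_
      rw [mem_powKer, ← mul_apply_eq_comp, ← pow_add,
        show (i : ℕ) + 1 + (n - 1 - i) = n by omega, hTn]
    intro i l hil
    rcases lt_or_gt_of_ne hil with h | h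
    · exact key i l h
    · exact inner_eq_zero_symm.1 (key l i h)
  · intro i
    simp only [jordanBlock, Matrix.of_apply, ite_smul, one_smul, zero_smul]
    rw [← mul_apply_eq_comp, ← pow_succ']
    rcases Nat.eq_zero_or_pos (i : ℕ) with hi | hi
    · rw [Finset.sum_eq_zero fun l _ => if_neg (by omega)]
      rw [hi, show n - 1 - 0 + 1 = n by omega, hTn]
    · rw [Finset.sum_eq_single (⟨i - 1, by omega⟩ : Fin n)]
      · rw [if_pos (by simp; omega)]
        congr 2
        simp only
        omega
      · intro l _ hl
        refine if_neg fun h => hl (Fin.ext ?_)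
        simp only
        omega
      · intro h; exact absurd (Finset.mem_univ _) h

end DefectOne

/-! ### Unitary similarity to the Jordan block -/

section UnitarySimilarity

open Matrix

theorem unitarilySimilar_jordanBlock_of_growth {n : ℕ} {A : Matrix (Fin n) (Fin n) ℂ}
    (hrank : (1 - Aᴴ * A).rank ≤ 1) (hG : HasPowKernelGrowth A) :
    UnitarilySimilar A (jordanBlock n) := by
  have hD : ∃ v : EuclideanSpace ℂ (Fin n), ∀ x, ∃ a : ℂ,
      x - ContinuousLinearMap.adjoint (toEuclideanCLM (𝕜 := ℂ) A) (toEuclideanCLM (𝕜 := ℂ) A x) =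
        a • v := by
    rw [Matrix.rank, finrank_le_one_iff] at hrank
    obtain ⟨v, hv⟩ := hrank
    refine ⟨WithLp.toLp 2 v.1, fun x => ?_⟩
    obtain ⟨a, ha⟩ := hv ⟨(1 - Aᴴ * A).mulVecLin x.ofLp, LinearMap.mem_range_self _ _⟩
    refine ⟨a, ?_⟩
    have h1 := congrArg Subtype.val ha
    have h2 : a • v.1 = (1 - Aᴴ * A) *ᵥ x.ofLp := h1
    rw [← WithLp.toLp_smul, h2, ← ContinuousLinearMap.star_eq_adjoint, ← map_star,
      ← mul_apply_eq_comp, ← map_mul, Matrix.sub_mulVec, one_mulVec, WithLp.toLp_sub,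
      ← toEuclideanCLM_toLp]
    rfl
  have hG' : HasPowKernelGrowth (toEuclideanCLM (𝕜 := ℂ) A) := 
    hG.map (toEuclideanCLM (𝕜 := ℂ) (n := Fin n))
  obtain ⟨e, he, heT⟩ := exists_orthonormal_chain (n := n) (by simp) hD hG'
  set V : Matrix (Fin n) (Fin n) ℂ := Matrix.of fun a i => e i a with hV
  have hVV : Vᴴ * V = 1 := by
    ext i j
    have h1 := orthonormal_iff_ite.1 he i j
    rw [Matrix.one_apply, ← h1, PiLp.inner_apply]
    simp [hV, Matrix.mul_apply, mul_comm]
  have hVV' : V * Vᴴ = 1 := mul_eq_one_comm.1 hVV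
  have hAV : A * V = V * jordanBlock n := by
    ext a i
    have h1 := congrArg (fun v : EuclideanSpace ℂ (Fin n) => v a) (heT i)
    simp only [ofLp_toEuclideanCLM] at h1
    rw [Matrix.mul_apply, Matrix.mul_apply]
    simpa [hV, mulVec, dotProduct, mul_comm] using h1
  refine ⟨Vᴴ, ?_, ?_⟩
  · rw [mem_unitaryGroup_iff, star_eq_conjTranspose, conjTranspose_conjTranspose, hVV]
  · rw [conjTranspose_conjTranspose, ← hAV, mul_assoc, hVV', mul_one]

end UnitarySimilarity

/-! ### Rotation invariance and circular numerical ranges -/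

section CircularNumericalRange

open Matrix

variable {ι : Type*} [Fintype ι] [DecidableEq ι]

theorem UnitarilySimilar.symm {A B : Matrix ι ι ℂ} (h : UnitarilySimilar A B) :
    UnitarilySimilar B A := by
  obtain ⟨U, hU, rfl⟩ := h
  have h1 : U * Uᴴ = 1 := mem_unitaryGroup_iff.1 hU
  have h2 : Uᴴ * U = 1 := mul_eq_one_comm.1 h1
  refine ⟨Uᴴ, mem_unitaryGroup_iff.2 (by
    rw [star_eq_conjTranspose, conjTranspose_conjTranspose, h2]), ?_⟩
  rw [conjTranspose_conjTranspose]
  calc B = (U * Uᴴ) * B * (U * Uᴴ) := by rw [h1, one_mul, mul_one]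
    _ = _ := by simp only [mul_assoc]

theorem UnitarilySimilar.numericalRange_subset {A B : Matrix ι ι ℂ} (h : UnitarilySimilar A B) :
    numericalRange A ⊆ numericalRange B := by
  obtain ⟨U, hU, rfl⟩ := h
  have h2 : star U * U = 1 := mul_eq_one_comm.1 (mem_unitaryGroup_iff.1 hU)
  rintro _ ⟨x, hx, rfl⟩
  refine ⟨toEuclideanCLM (𝕜 := ℂ) U x, ?_, ?_⟩
  · have h3 : inner ℂ (toEuclideanCLM (𝕜 := ℂ) U x) (toEuclideanCLM (𝕜 := ℂ) U x) = inner ℂ x x := by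
      rw [← ContinuousLinearMap.adjoint_inner_right, ← ContinuousLinearMap.star_eq_adjoint,
        ← map_star, ← mul_apply_eq_comp, ← map_mul, h2, map_one, one_apply_eq_self]
    rw [← hx, norm_eq_sqrt_re_inner (𝕜 := ℂ), h3, ← norm_eq_sqrt_re_inner]
  · rw [← ContinuousLinearMap.adjoint_inner_right, ← ContinuousLinearMap.star_eq_adjoint,
      ← map_star, ← mul_apply_eq_comp, ← mul_apply_eq_comp, ← map_mul, ← map_mul]
    rfl

theorem UnitarilySimilar.numericalRange_eq {A B : Matrix ι ι ℂ} (h : UnitarilySimilar A B) :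
    numericalRange A = numericalRange B :=
  h.numericalRange_subset.antisymm h.symm.numericalRange_subset

theorem UnitarilySimilar.kronecker_self {A B : Matrix ι ι ℂ} (h : UnitarilySimilar A B) :
    UnitarilySimilar (A ⊗ₖ A) (B ⊗ₖ B) := by
  obtain ⟨U, hU, rfl⟩ := h
  refine ⟨U ⊗ₖ U, kronecker_mem_unitary hU hU, ?_⟩
  rw [conjTranspose_kronecker, ← mul_kronecker_mul, ← mul_kronecker_mul]

/-- The range is a union of circles about 0. Their radii fill an interval from 0 to a maximum,
because the unit sphere is connected and compact. -/
theorem isDiscAtOrigin_of_rotation {A : Matrix ι ι ℂ}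
    (hrot : ∀ z : ℂ, ‖z‖ = 1 → UnitarilySimilar (z • A) A) (h0 : (0 : ℂ) ∈ numericalRange A) :
    IsDiscAtOrigin (numericalRange A) := by
  set T := toEuclideanCLM (𝕜 := ℂ) A with hT
  have hrot' : ∀ z : ℂ, ‖z‖ = 1 → ∀ w ∈ numericalRange A, z * w ∈ numericalRange A := by
    rintro z hz w ⟨x, hx, rfl⟩
    refine (hrot z hz).numericalRange_subset ⟨x, hx, ?_⟩
    rw [map_smul, _root_.smul_apply, inner_smul_right]
  obtain ⟨x₀, hx₀, hx₀0⟩ := h0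
  let f : EuclideanSpace ℂ ι → ℝ := fun x => ‖inner ℂ x (T x)‖
  have hf : Continuous f := by fun_prop
  have hcompact : IsCompact (Metric.sphere (0 : EuclideanSpace ℂ ι) 1) := isCompact_sphere _ _
  have hmem₀ : x₀ ∈ Metric.sphere (0 : EuclideanSpace ℂ ι) 1 := by simpa using hx₀
  obtain ⟨x₁, hx₁, hmax⟩ := hcompact.exists_isMaxOn ⟨x₀, hmem₀⟩ hf.continuousOn
  have hpre : IsPreconnected (Metric.sphere (0 : EuclideanSpace ℂ ι) 1) := by
    refine isPreconnected_sphere ?_ _ _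
    have : Nontrivial (EuclideanSpace ℂ ι) := ⟨x₀, 0, by rintro rfl; simp at hx₀⟩
    have h1 : 0 < Module.finrank ℂ (EuclideanSpace ℂ ι) := Module.finrank_pos
    have h2 := finrank_real_of_complex (EuclideanSpace ℂ ι)
    rw [← Module.finrank_eq_rank]
    exact_mod_cast (by omega : 1 < Module.finrank ℝ (EuclideanSpace ℂ ι))
  refine ⟨f x₁, norm_nonneg _, Set.Subset.antisymm ?_ ?_⟩
  · rintro _ ⟨x, hx, rfl⟩
    rw [mem_closedBall_zero_iff]
    exact hmax (show x ∈ Metric.sphere (0 : EuclideanSpace ℂ ι) 1 by simpa using hx)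
  · intro w hw
    rw [mem_closedBall_zero_iff] at hw
    have hf0 : f x₀ = 0 := by
      change ‖inner ℂ x₀ (T x₀)‖ = 0
      rw [hT, ← hx₀0, norm_zero]
    obtain ⟨x, hx, hxw⟩ := hpre.intermediate_value hmem₀ hx₁ hf.continuousOn
      (show ‖w‖ ∈ Set.Icc (f x₀) (f x₁) from ⟨by rw [hf0]; exact norm_nonneg _, hw⟩)
    have hxmem : inner ℂ x (T x) ∈ numericalRange A := ⟨x, by simpa using hx, rfl⟩
    rcases eq_or_ne w 0 with rfl | hw0
    · rw [norm_zero, norm_eq_zero] at hxw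
      rwa [hxw] at hxmem
    · have hne : inner ℂ x (T x) ≠ 0 := by
        rw [← norm_ne_zero_iff]
        change f x ≠ 0
        rw [hxw]
        exact norm_ne_zero_iff.2 hw0
      have h1 := hrot' (w / inner ℂ x (T x)) (by
        rw [norm_div]
        change ‖w‖ / f x = 1
        rw [hxw, div_self (norm_ne_zero_iff.2 hw0)]) _ hxmem
      rwa [div_mul_cancel₀ _ hne] at h1

theorem diag_mem_numericalRange (A : Matrix ι ι ℂ) (i : ι) : A i i ∈ numericalRange A := by
  refine ⟨EuclideanSpace.single i 1, by simp, ?_⟩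
  rw [EuclideanSpace.inner_single_left]
  simp [ofLp_toEuclideanCLM]

/-- Conjugation by diag(z^i) multiplies the entry (i, i + 1) by z̄^i z^(i+1) = z. -/
theorem exists_unitary_smul_jordanBlock (n : ℕ) (z : ℂ) (hz : ‖z‖ = 1) :
    ∃ U ∈ unitaryGroup (Fin n) ℂ, z • jordanBlock n = Uᴴ * jordanBlock n * U := by
  have hzz : ∀ k : ℕ, z ^ k * star (z ^ k) = 1 := by
    intro k
    rw [Complex.star_def, Complex.mul_conj, Complex.normSq_eq_norm_sq, norm_pow, hz]
    simp
  refine ⟨diagonal fun i => z ^ (i : ℕ), ?_, ?_⟩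
  · rw [mem_unitaryGroup_iff, star_eq_conjTranspose, diagonal_conjTranspose, diagonal_mul_diagonal,
      ← diagonal_one]
    congr 1
    ext i
    exact hzz i
  · ext i j
    rw [diagonal_conjTranspose, mul_diagonal, diagonal_mul]
    simp only [jordanBlock, Matrix.smul_apply, of_apply, smul_eq_mul, Pi.star_apply]
    split_ifs with h
    · rw [h, pow_succ]
      linear_combination (-z) * hzz i
    · simp

theorem isDiscAtOrigin_numericalRange_jordanBlock {n : ℕ} (hn : 0 < n) :
    IsDiscAtOrigin (numericalRange (jordanBlock n)) := by
  refine isDiscAtOrigin_of_rotation (exists_unitary_smul_jordanBlock n) ?_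
  have := diag_mem_numericalRange (jordanBlock n) ⟨0, hn⟩
  simpa [jordanBlock] using this

theorem isDiscAtOrigin_numericalRange_jordanBlock_kronecker {n : ℕ} (hn : 0 < n) :
    IsDiscAtOrigin (numericalRange (jordanBlock n ⊗ₖ jordanBlock n)) := by
  refine isDiscAtOrigin_of_rotation (fun z hz => ?_) ?_
  · obtain ⟨U, hU, h⟩ := exists_unitary_smul_jordanBlock n z hz
    -- Rotating one tensor factor suffices: (zJ) ⊗ J = z(J ⊗ J).
    refine ⟨U ⊗ₖ 1, kronecker_mem_unitary hU (one_mem _), ?_⟩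
    rw [conjTranspose_kronecker, ← mul_kronecker_mul, ← mul_kronecker_mul, ← h, smul_kronecker]
    simp
  · have := diag_mem_numericalRange (jordanBlock n ⊗ₖ jordanBlock n) (⟨0, hn⟩, ⟨0, hn⟩)
    simpa [jordanBlock] using this

end CircularNumericalRange

/-! ### The equivalence -/

theorem theorem3p3 (n : ℕ) (A : Matrix (Fin n) (Fin n) ℂ) (hA : IsSnMatrix A) :
    List.TFAE [
      IsDiscAtOrigin (numericalRange A),
      IsDiscAtOrigin (numericalRange (A ⊗ₖ A)),
      UnitarilySimilar A (jordanBlock n)] := by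
  have hn : 0 < n := by
    rcases Nat.eq_zero_or_pos n with rfl | h
    · have h1 := hA.rank_defect
      have h2 := Matrix.rank_le_width (1 - A.conjTranspose * A)
      omega
    · exact h
  tfae_have 1 → 3 := fun h =>
    unitarilySimilar_jordanBlock_of_growth hA.rank_defect.le (hasPowKernelGrowth_of_isDiscAtOrigin h)
  tfae_have 2 → 3 := fun h =>
    unitarilySimilar_jordanBlock_of_growth hA.rank_defect.le
      (hasPowKernelGrowth_of_isDiscAtOrigin h).of_kronecker_self
  tfae_have 3 → 1 := fun h => by
    rw [h.numericalRange_eq]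
    exact isDiscAtOrigin_numericalRange_jordanBlock hn
  tfae_have 3 → 2 := fun h => by
    rw [h.kronecker_self.numericalRange_eq]
    exact isDiscAtOrigin_numericalRange_jordanBlock_kronecker hn
  tfae_finish
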